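/- Let $p(z)=a_0z^n+a_1z^{n-1}+\cdots+a_n$ be a polynomial of degree $n$ with real coefficients, $a_0>0$ and $a_n\neq 0$. Its finite Hurwitz matrix is the $n\times n$ matrix $\mathcal H_n(p)=(a_{2j-i})_{i,j=1}^n$, where $a_k=0$ for $k<0$ and for $k>n$. For $1\le j\le n$ let $\Delta_j(p)$ be its leading principal minor of order $j$, and put $\Delta_j(p)=1$ for $j\le 0$. A matrix is totally nonnegative if all its minors are nonnegative. The polynomial $p$ is quasi-stable with stability index $m$, $0\le m\le n$, if all its complex zeros lie in the closed left half-plane and exactly $n-m$ of them, counted with multiplicity, lie on the imaginary axis. Then the following are equivalent: 1. $p$ is quasi-stable with stability index at least $n-2$; 2. $\mathcal H_n(p)$ is totally nonnegative and $\Delta_{n-2}(p)\neq 0$. -/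

import Mathlib

open Polynomial

noncomputable section

/-- For `p(z) = a_0 z^n + a_1 z^(n-1) + ... + a_n` with `n = deg p`, the coefficient `a_k`,
with the convention `a_k = 0` for `k > n`. -/
def descCoeff (p : ℝ[X]) (k : ℕ) : ℝ :=
  if k ≤ p.natDegree then p.coeff (p.natDegree - k) else 0

/-- The finite Hurwitz matrix of `p`, of size `n × n` with `n = deg p`. Counting rows and columns
from `1`, its entry in row `i` and column `j` is `a_(2j-i)`, which is `0` when `2j - i < 0` or
`2j - i > n`; counting from `0`, as in the code, the index is `2j + 1 - i`. -/
def hurwitzMatrix (p : ℝ[X]) : Matrix (Fin p.natDegree) (Fin p.natDegree) ℝ :=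
  Matrix.of fun i j =>
    if (i : ℕ) ≤ 2 * (j : ℕ) + 1 then descCoeff p (2 * (j : ℕ) + 1 - (i : ℕ)) else 0

/-- The Hurwitz minor `Δ_j(p)`: the leading principal minor of order `j ≤ n` of the finite
Hurwitz matrix (`Δ_0(p) = 1`, the determinant of the empty matrix). -/
def hurwitzMinor (p : ℝ[X]) (j : ℕ) (hj : j ≤ p.natDegree) : ℝ :=
  ((hurwitzMatrix p).submatrix (Fin.castLE hj) (Fin.castLE hj)).det

/-- A real matrix is totally nonnegative if all its minors, of all orders, are nonnegative. -/
def IsTotallyNonnegative {m n : ℕ} (A : Matrix (Fin m) (Fin n) ℝ) : Prop :=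
  ∀ (k : ℕ) (r : Fin k ↪o Fin m) (c : Fin k ↪o Fin n), 0 ≤ (A.submatrix r c).det

/-- `p` is quasi-stable with stability index `m`, `0 ≤ m ≤ n = deg p`: all its complex zeros lie in
the closed left half-plane, and the number of its zeros on the imaginary axis, counted with
multiplicities, equals `n - m`. -/
def IsQuasiStableWithIndex (p : ℝ[X]) (m : ℕ) : Prop :=
  m ≤ p.natDegree ∧
  (∀ z ∈ p.aroots ℂ, z.re ≤ 0) ∧
  (p.aroots ℂ).countP (fun z => z.re = 0) = p.natDegree - m

end

/-! Let a_0, a_1 be the two leading coefficients of p, with a_1 > 0, and put c = a_0/a_1. The Routh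
step removes the leading term of p and leaves a polynomial q of degree one less, with leading
coefficient a_1 and the same constant term. Both sides of the equivalence follow this step, so
induction on the degree applies.

On the matrix side, each row of the bi-infinite Hurwitz matrix of p is a nonnegative combination of
two adjacent rows of that of q. Hence total nonnegativity passes from q to p, and Δ_{j+1}(p) = a_1
Δ_j(q) (`hurwitzMinorInt_succ`). On the zero side, p and q have the same zeros on the imaginary axis
with multiplicity (`imaginaryZeroCount_routhStep`), and the zeros of p lie in the closed left
half-plane exactly when those of q do.

For necessity, the recursion stops when a_1 = 0: by Vieta all zeros are then on the axis, so the
degree is at most 2. For sufficiency, total nonnegativity and Δ_{n-2} ≠ 0 give Δ_j > 0 for j ≤ n-2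
(`IsTotallyNonnegative.leading_minor_pos`), so the step can be repeated down to degree 2. -/

/-! ### Totally nonnegative bi-infinite matrices -/

/-- Total nonnegativity of a matrix with rows and columns indexed by the integers. -/
def IsTotallyNonnegativeInt (A : ℤ → ℤ → ℝ) : Prop :=
  ∀ (k : ℕ) (r c : Fin k → ℤ), StrictMono r → StrictMono c →
    0 ≤ (Matrix.of fun i j => A (r i) (c j)).det

namespace IsTotallyNonnegativeInt

theorem det_nonneg_of_monotone {A : ℤ → ℤ → ℝ} (hA : IsTotallyNonnegativeInt A) {k : ℕ}
    {r c : Fin k → ℤ} (hr : Monotone r) (hc : StrictMono c) :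
    0 ≤ (Matrix.of fun i j => A (r i) (c j)).det := by
  by_cases h : Function.Injective r
  · exact hA k r c (hr.strictMono_of_injective h) hc
  · simp only [Function.Injective, not_forall] at h
    obtain ⟨i, j, hij, hne⟩ := h
    rw [Matrix.det_zero_of_row_eq hne (by ext l; simp [hij])]

/-- Multilinearity expands a minor of `B` into nonnegative multiples of determinants of `A`, with
row `r i` or `r i + 1` chosen for each `i`. Since `r` is strictly increasing, the chosen rows are
weakly increasing, and a repetition gives zero. -/
theorem smul_add_smul_succ_row {A B : ℤ → ℤ → ℝ} (hA : IsTotallyNonnegativeInt A) (α β : ℤ → ℝ)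
    (hα : ∀ i, 0 ≤ α i) (hβ : ∀ i, 0 ≤ β i)
    (hB : ∀ i j, B i j = α i * A i j + β i * A (i + 1) j) : IsTotallyNonnegativeInt B := by
  intro k r c hr hc
  have h1 : (Matrix.of fun i j => B (r i) (c j)) =
      (Matrix.of fun i j => α (r i) * A (r i) (c j)) +
      (Matrix.of fun i j => β (r i) * A (r i + 1) (c j)) := by
    ext i j; simp [hB]
  have h2 : ((Matrix.of fun i j => α (r i) * A (r i) (c j)) +
      (Matrix.of fun i j => β (r i) * A (r i + 1) (c j))).det =
      ∑ s : Finset (Fin k), Matrix.det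
        (s.piecewise (Matrix.of fun i j => α (r i) * A (r i) (c j))
          (Matrix.of fun i j => β (r i) * A (r i + 1) (c j))) :=
    (Matrix.detRowAlternating (n := Fin k) (R := ℝ)).toMultilinearMap.map_add_univ _ _
  rw [h1, h2]
  refine Finset.sum_nonneg fun s _ => ?_
  have h3 : s.piecewise (Matrix.of fun i j => α (r i) * A (r i) (c j))
          (Matrix.of fun i j => β (r i) * A (r i + 1) (c j)) =
      Matrix.of fun i j => (if i ∈ s then α (r i) else β (r i)) *
        Matrix.of (fun i j => A (if i ∈ s then r i else r i + 1) (c j)) i j := by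
    funext i j
    by_cases hi : i ∈ s <;> simp [Finset.piecewise, hi]
  rw [h3, Matrix.det_mul_column]
  refine mul_nonneg (Finset.prod_nonneg fun i _ => ?_) (hA.det_nonneg_of_monotone ?_ hc)
  · split_ifs
    · exact hα _
    · exact hβ _
  · intro i j hij
    rcases hij.eq_or_lt with rfl | hlt
    · exact le_rfl
    · have := hr hlt
      dsimp only
      split_ifs <;> omega

theorem of_double {a : ℝ} (ha : 0 ≤ a) :
    IsTotallyNonnegativeInt fun i j => if i = 2 * j then a else 0 := by
  intro k r c hr hc
  rw [Matrix.det_apply]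
  refine Finset.sum_nonneg fun σ _ => ?_
  by_cases h : ∀ i, r (σ i) = 2 * c i
  · have hσ : StrictMono σ := by
      intro i j hij
      rw [← hr.lt_iff_lt, h, h]
      have := hc hij
      omega
    have : σ = 1 := by
      ext i
      exact congrArg Fin.val (congrFun (hσ.range_inj strictMono_id |>.1 (by simp)) i)
    subst this
    simp only [Equiv.Perm.sign_one, one_smul]
    refine Finset.prod_nonneg fun i _ => ?_
    simp only [Matrix.of_apply]
    split_ifs <;> simp [ha]
  · push Not at h
    obtain ⟨i, hi⟩ := h
    rw [Finset.prod_eq_zero (Finset.mem_univ i) (by simp [hi]), smul_zero]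

theorem transpose {A : ℤ → ℤ → ℝ} (hA : IsTotallyNonnegativeInt A) :
    IsTotallyNonnegativeInt fun i j => A j i := by
  intro k r c hr hc
  rw [← Matrix.det_transpose]
  exact hA k c r hc hr

theorem shift {A : ℤ → ℤ → ℝ} (hA : IsTotallyNonnegativeInt A) (a b : ℤ) :
    IsTotallyNonnegativeInt fun i j => A (i + a) (j + b) := fun k r c hr hc =>
  hA k (fun i => r i + a) (fun i => c i + b) (fun _ _ h => by simpa using hr h)
    (fun _ _ h => by simpa using hc h)

end IsTotallyNonnegativeInt

/-! ### Schur complements of finite totally nonnegative matrices -/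

/-- Elimination of the first column by the corner entry of a square matrix. -/
theorem Matrix.det_eq_mul_det_schur {k : ℕ} (A : Matrix (Fin (k + 1)) (Fin (k + 1)) ℝ)
    (h : A 0 0 ≠ 0) :
    A.det = A 0 0 *
      (Matrix.of fun i j : Fin k => A i.succ j.succ - A i.succ 0 / A 0 0 * A 0 j.succ).det := by
  have h1 : A.det = (Matrix.of fun i j => A i j -
      (Fin.cases 0 (fun l => A l.succ 0 / A 0 0) i : ℝ) * A 0 j).det := by
    refine Matrix.det_eq_of_forall_row_eq_smul_add_const
      (fun i => (Fin.cases 0 (fun l => A l.succ 0 / A 0 0) i : ℝ)) 0 rfl fun i j => ?_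
    simp
  rw [h1, Matrix.det_succ_column_zero, Fin.sum_univ_succ, Finset.sum_eq_zero]
  · simp only [Fin.val_zero, pow_zero, Matrix.of_apply, Fin.cases_zero, zero_mul, sub_zero, one_mul,
      add_zero]
    rfl
  · intro i _
    simp [h]

theorem IsTotallyNonnegative.submatrix {m n m' n' : ℕ} {A : Matrix (Fin m) (Fin n) ℝ}
    (hA : IsTotallyNonnegative A) (r : Fin m' ↪o Fin m) (c : Fin n' ↪o Fin n) :
    IsTotallyNonnegative (A.submatrix r c) := fun k r' c' =>
  hA k (r'.trans r) (c'.trans c)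

theorem IsTotallyNonnegative.entry_nonneg {m n : ℕ} {A : Matrix (Fin m) (Fin n) ℝ}
    (hA : IsTotallyNonnegative A) (i : Fin m) (j : Fin n) : 0 ≤ A i j := by
  have := hA 1 (OrderEmbedding.ofStrictMono (fun _ => i) (fun a b h => by omega))
    (OrderEmbedding.ofStrictMono (fun _ => j) (fun a b h => by omega))
  rw [Matrix.det_fin_one] at this
  exact this

theorem IsTotallyNonnegative.entry_mul_le {m n : ℕ} {A : Matrix (Fin (m + 1)) (Fin (n + 1)) ℝ}
    (hA : IsTotallyNonnegative A) (i : Fin m) (j : Fin n) :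
    A 0 j.succ * A i.succ 0 ≤ A 0 0 * A i.succ j.succ := by
  have := hA 2 (OrderEmbedding.ofStrictMono ![0, i.succ] (by simp))
    (OrderEmbedding.ofStrictMono ![0, j.succ] (by simp))
  rw [Matrix.det_fin_two] at this
  simpa using this

/-- If the corner is zero, the 2 × 2 minors through it force the whole first row or the whole first
column to vanish. -/
theorem IsTotallyNonnegative.corner_pos {k : ℕ} {A : Matrix (Fin (k + 1)) (Fin (k + 1)) ℝ}
    (hA : IsTotallyNonnegative A) (hdet : A.det ≠ 0) : 0 < A 0 0 := by
  refine (hA.entry_nonneg 0 0).lt_of_ne' fun h0 => hdet ?_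
  by_cases hrow : ∀ j, A 0 j = 0
  · exact Matrix.det_eq_zero_of_row_eq_zero 0 hrow
  · push Not at hrow
    obtain ⟨j, hj⟩ := hrow
    refine Matrix.det_eq_zero_of_column_eq_zero 0 fun i => ?_
    induction j using Fin.cases with
    | zero => exact absurd h0 hj
    | succ j =>
      induction i using Fin.cases with
      | zero => exact h0
      | succ i =>
        have h1 := hA.entry_mul_le i j
        have h2 := (hA.entry_nonneg 0 j.succ).lt_of_ne' hj
        have h3 := hA.entry_nonneg i.succ 0
        rw [h0, zero_mul] at h1
        nlinarith

/-- A minor of the Schur complement, times the corner, is the minor of `A` bordered by the first row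
and column. -/
theorem IsTotallyNonnegative.schur {k : ℕ} {A : Matrix (Fin (k + 1)) (Fin (k + 1)) ℝ}
    (hA : IsTotallyNonnegative A) (h : 0 < A 0 0) :
    IsTotallyNonnegative
      (Matrix.of fun i j : Fin k => A i.succ j.succ - A i.succ 0 / A 0 0 * A 0 j.succ) := by
  intro l r c
  have ext_mono : ∀ f : Fin l ↪o Fin k,
      StrictMono (Fin.cons 0 (Fin.succ ∘ f) : Fin (l + 1) → Fin (k + 1)) := by
    intro f i j hij
    induction j using Fin.cases with
    | zero => exact absurd hij (Fin.not_lt_zero i)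
    | succ j =>
      induction i using Fin.cases with
      | zero => simp
      | succ i => simpa using hij
  have h1 := hA (l + 1) (OrderEmbedding.ofStrictMono _ (ext_mono r))
    (OrderEmbedding.ofStrictMono _ (ext_mono c))
  rw [Matrix.det_eq_mul_det_schur _ (by simpa using h.ne')] at h1
  exact (mul_nonneg_iff_of_pos_left h).1 h1

theorem IsTotallyNonnegative.leading_minor_pos {k : ℕ} {A : Matrix (Fin k) (Fin k) ℝ}
    (hA : IsTotallyNonnegative A) (hdet : A.det ≠ 0) (j : ℕ) (hj : j ≤ k) :
    0 < (A.submatrix (Fin.castLE hj) (Fin.castLE hj)).det := by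
  induction k generalizing j with
  | zero =>
    obtain rfl : j = 0 := by omega
    simp
  | succ k ih =>
    cases j with
    | zero => simp
    | succ j =>
      have h0 := hA.corner_pos hdet
      have hd := hdet
      rw [Matrix.det_eq_mul_det_schur _ h0.ne'] at hd
      have h1 := ih (hA.schur h0) (right_ne_zero_of_mul hd) j (by omega)
      rw [Matrix.det_eq_mul_det_schur _ (by simpa using h0.ne')]
      exact mul_pos (by simpa using h0) h1

/-! ### Algebra of the Routh step -/

/-- The Routh step `p - (c/2) z (p(z) - (-1)^n p(-z))` with `n = deg p`; it cancels the leading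
term when `c` is the quotient of the two leading coefficients. -/
noncomputable def routhStep (p : ℝ[X]) (c : ℝ) : ℝ[X] :=
  p - C (c / 2) * X * (p - C ((-1) ^ p.natDegree) * p.comp (-X))

theorem Polynomial.coeff_comp_neg_X (p : ℝ[X]) (k : ℕ) :
    (p.comp (-X)).coeff k = (-1) ^ k * p.coeff k := by
  have h : p.comp (-X) = p.comp (C (-1) * X) := by simp
  rw [h, comp_C_mul_X_coeff, mul_comm]

theorem coeff_zero_routhStep (p : ℝ[X]) (c : ℝ) : (routhStep p c).coeff 0 = p.coeff 0 := by
  simp [routhStep, mul_assoc]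

theorem coeff_succ_routhStep (p : ℝ[X]) (c : ℝ) (k : ℕ) :
    (routhStep p c).coeff (k + 1) =
      p.coeff (k + 1) - if Odd (p.natDegree + k) then c * p.coeff k else 0 := by
  rw [routhStep, mul_assoc, coeff_sub, coeff_C_mul, coeff_X_mul, coeff_sub, coeff_C_mul,
    Polynomial.coeff_comp_neg_X, ← mul_assoc, ← pow_add]
  split_ifs with h
  · rw [h.neg_one_pow]; ring
  · rw [(Nat.not_odd_iff_even.1 h).neg_one_pow]; ring

section
variable {p : ℝ[X]} {c : ℝ} {n : ℕ} (hn : p.natDegree = n + 1)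
  (hc : c * p.coeff n = p.leadingCoeff) (h1 : 0 < p.coeff n)
include hn hc

theorem natDegree_routhStep_le : (routhStep p c).natDegree ≤ n := by
  rw [natDegree_le_iff_coeff_eq_zero]
  intro k hk
  obtain ⟨k, rfl⟩ : ∃ l, k = l + 1 := ⟨k - 1, by omega⟩
  rw [coeff_succ_routhStep]
  rcases eq_or_lt_of_le (show n ≤ k by omega) with rfl | hlt
  · rw [if_pos (by rw [hn]; exact ⟨n, by ring⟩), hc, leadingCoeff, hn, sub_self]
  · rw [coeff_eq_zero_of_natDegree_lt (by omega)]
    rcases eq_or_lt_of_le (show n + 1 ≤ k by omega) with rfl | hlt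
    · rw [if_neg (by rw [hn, Nat.not_odd_iff_even]; exact ⟨n + 1, rfl⟩), sub_zero]
    · rw [coeff_eq_zero_of_natDegree_lt (by omega)]; simp

theorem coeff_routhStep_self : (routhStep p c).coeff n = p.coeff n := by
  cases n with
  | zero => exact coeff_zero_routhStep p c
  | succ k =>
    rw [coeff_succ_routhStep, if_neg (by rw [hn, Nat.not_odd_iff_even]; exact ⟨k + 1, by ring⟩),
      sub_zero]

include h1

theorem natDegree_routhStep : (routhStep p c).natDegree = n := by
  refine le_antisymm (natDegree_routhStep_le hn hc) (le_natDegree_of_ne_zero ?_)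
  rw [coeff_routhStep_self hn hc]
  exact h1.ne'

theorem leadingCoeff_routhStep : (routhStep p c).leadingCoeff = p.coeff n := by
  rw [leadingCoeff, natDegree_routhStep hn hc h1, coeff_routhStep_self hn hc]

/-- The step changes only coefficients whose degree has the parity of `p.natDegree`; both sides are
twice the untouched part. This makes the step invertible. -/
theorem sub_reflect_eq_routhStep_add_reflect :
    p - C ((-1) ^ p.natDegree) * p.comp (-X) =
    routhStep p c + C ((-1) ^ (routhStep p c).natDegree) * (routhStep p c).comp (-X) := by
  rw [natDegree_routhStep hn hc h1, routhStep, hn]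
  simp only [sub_comp, mul_comp, C_comp, X_comp, comp_neg_X_comp_neg_X, pow_succ, C_mul, C_neg,
    C_pow, C_1]
  have : ((-1 : ℝ[X]) ^ n) * (-1) ^ n = 1 := by rw [← mul_pow]; simp
  have h2 : ((-1 : ℝ[X]) ^ n).comp (-X) = (-1) ^ n := by
    rw [← C_1, ← C_neg, ← C_pow, C_comp]
  have h3 : (-1 : ℝ[X]).comp (-X) = -1 := by
    rw [← C_1, ← C_neg, C_comp]
  rw [h2, h3]
  linear_combination -(C (c / 2) * X * p) * this

theorem eq_routhStep_add : p = routhStep p c + C (c / 2) * X *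
    (routhStep p c + C ((-1) ^ (routhStep p c).natDegree) * (routhStep p c).comp (-X)) := by
  rw [← sub_reflect_eq_routhStep_add_reflect hn hc h1, routhStep]
  ring

end

/-! ### Hurwitz matrices and minors under the Routh step -/

/-- The coefficient `a_k` of `p(z) = a_0 z^n + a_1 z^(n-1) + ... + a_n`, for integral `k`. -/
noncomputable def descCoeffInt (p : ℝ[X]) (k : ℤ) : ℝ :=
  if 0 ≤ k then descCoeff p k.toNat else 0

/-- Write b_k for the coefficients of the reduced polynomial. For odd k nothing changes, so b_{k-1}
= a_k; for even k, b_{k-1} = a_k - c a_{k+1} = a_k - c b_k. -/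
theorem descCoeffInt_routhStep {p : ℝ[X]} {c : ℝ} {n : ℕ} (hn : p.natDegree = n + 1)
    (hc : c * p.coeff n = p.leadingCoeff) (h1 : 0 < p.coeff n) (k : ℤ) :
    descCoeffInt p k = descCoeffInt (routhStep p c) (k - 1) +
      if Even k then c * descCoeffInt (routhStep p c) k else 0 := by
  have hq := natDegree_routhStep hn hc h1
  have hl : p.coeff (n + 1) = p.leadingCoeff := by rw [leadingCoeff, hn]
  simp only [descCoeffInt, descCoeff, hn, hq]
  rcases lt_or_ge k 0 with hk | hk
  · simp [show ¬ (0 : ℤ) ≤ k by omega, show ¬ (1 : ℤ) ≤ k by omega]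
  lift k to ℕ using hk
  simp only [Int.natCast_nonneg, if_true, Int.toNat_natCast, Int.even_coe_nat]
  rcases Nat.eq_zero_or_pos k with rfl | hk
  · simp [hl, ← hc, coeff_routhStep_self hn hc]
  obtain ⟨l, rfl⟩ : ∃ l, k = l + 1 := ⟨k - 1, by omega⟩
  have e1 : ((l + 1 : ℕ) : ℤ) - 1 = l := by push_cast; ring
  rw [e1]
  simp only [Int.natCast_nonneg, if_true, Int.toNat_natCast]
  rcases lt_trichotomy l n with h | rfl | h
  · obtain ⟨d, rfl⟩ : ∃ d, n = l + 1 + d := ⟨n - (l + 1), by omega⟩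
    rw [if_pos (show l + 1 ≤ l + 1 + d + 1 by omega), if_pos (show l ≤ l + 1 + d by omega),
      if_pos (show l + 1 ≤ l + 1 + d by omega),
      show l + 1 + d + 1 - (l + 1) = d + 1 by omega, show l + 1 + d - l = d + 1 by omega,
      show l + 1 + d - (l + 1) = d by omega, coeff_succ_routhStep, hn]
    by_cases he : Even (l + 1)
    · have ho : Odd (l + 1 + d + 1 + d) := by
        obtain ⟨t, ht⟩ := he; exact ⟨t + d, by omega⟩
      rw [if_pos ho, if_pos he]
      cases d with
      | zero => rw [coeff_zero_routhStep]; ring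
      | succ d =>
        rw [coeff_succ_routhStep, if_neg, sub_zero, sub_add_cancel]
        rw [hn, Nat.not_odd_iff_even]
        obtain ⟨t, ht⟩ := he
        exact ⟨t + d + 1, by omega⟩
    · have ho : ¬ Odd (l + 1 + d + 1 + d) := by
        rw [Nat.not_odd_iff_even]
        obtain ⟨t, ht⟩ := Nat.not_even_iff_odd.1 he; exact ⟨t + d + 1, by omega⟩
      rw [if_neg ho, if_neg he, sub_zero, add_zero]
  · simp [coeff_zero_routhStep]
  · rw [if_neg (show ¬ l + 1 ≤ n + 1 by omega), if_neg (show ¬ l ≤ n by omega),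
      if_neg (show ¬ l + 1 ≤ n by omega)]
    simp

/-- The bi-infinite Hurwitz matrix `(a_(2j-i))`. -/
noncomputable def hurwitzInt (p : ℝ[X]) (i j : ℤ) : ℝ := descCoeffInt p (2 * j - i)

theorem hurwitzInt_routhStep {p : ℝ[X]} {c : ℝ} {n : ℕ} (hn : p.natDegree = n + 1)
    (hc : c * p.coeff n = p.leadingCoeff) (h1 : 0 < p.coeff n) (i j : ℤ) :
    hurwitzInt p i j = hurwitzInt (routhStep p c) (i + 1) j +
      if Even i then c * hurwitzInt (routhStep p c) i j else 0 := by
  have : Even (2 * j - i) ↔ Even i := by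
    rw [Int.even_sub]; simp
  simp only [hurwitzInt, descCoeffInt_routhStep hn hc h1 (2 * j - i), this]
  congr 2
  ring

theorem hurwitzMatrix_apply (p : ℝ[X]) (i j : Fin p.natDegree) :
    hurwitzMatrix p i j = hurwitzInt p (i + 1) (j + 1) := by
  simp only [hurwitzMatrix, Matrix.of_apply, hurwitzInt, descCoeffInt]
  split_ifs with h h' h'
  · congr 1; omega
  · omega
  · omega
  · rfl

theorem isTotallyNonnegative_hurwitzMatrix {p : ℝ[X]} (h : IsTotallyNonnegativeInt (hurwitzInt p)) :
    IsTotallyNonnegative (hurwitzMatrix p) := by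
  intro k r c
  have := h k (fun i => (r i : ℕ) + 1) (fun i => (c i : ℕ) + 1)
    (fun i j hij => by have := r.strictMono hij; simpa using this)
    (fun i j hij => by have := c.strictMono hij; simpa using this)
  convert this using 2
  ext i j
  simp [hurwitzMatrix_apply]

theorem isTotallyNonnegativeInt_hurwitzInt_of_routhStep {p : ℝ[X]} {c : ℝ} {n : ℕ}
    (hn : p.natDegree = n + 1) (hc : c * p.coeff n = p.leadingCoeff) (h1 : 0 < p.coeff n)
    (hc0 : 0 ≤ c) (h : IsTotallyNonnegativeInt (hurwitzInt (routhStep p c))) :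
    IsTotallyNonnegativeInt (hurwitzInt p) := by
  refine h.smul_add_smul_succ_row (fun i => if Even i then c else 0) (fun _ => 1)
    (fun i => by split_ifs <;> simp [hc0]) (fun _ => zero_le_one) fun i j => ?_
  rw [hurwitzInt_routhStep hn hc h1]
  split_ifs <;> ring

/-- The leading principal minor of order `j` of the Hurwitz matrix, for every `j`. -/
noncomputable def hurwitzMinorInt (p : ℝ[X]) (j : ℕ) : ℝ :=
  (Matrix.of fun a b : Fin j => hurwitzInt p (a + 1) (b + 1)).det

theorem hurwitzMinor_eq (p : ℝ[X]) (j : ℕ) (hj : j ≤ p.natDegree) :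
    hurwitzMinor p j hj = hurwitzMinorInt p j := by
  rw [hurwitzMinor, hurwitzMinorInt]
  congr 1
  ext a b
  simp [hurwitzMatrix_apply]

theorem hurwitzMinorInt_zero (p : ℝ[X]) : hurwitzMinorInt p 0 = 1 := by
  simp [hurwitzMinorInt]

theorem descCoeffInt_one {p : ℝ[X]} {n : ℕ} (hn : p.natDegree = n + 1) :
    descCoeffInt p 1 = p.coeff n := by
  simp [descCoeffInt, descCoeff, hn]

theorem hurwitzMinorInt_one {p : ℝ[X]} {n : ℕ} (hn : p.natDegree = n + 1) :
    hurwitzMinorInt p 1 = p.coeff n := by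
  simp [hurwitzMinorInt, hurwitzInt, descCoeffInt_one hn]

/-- An even row of the matrix of `p` has an extra c times the same row of the reduced matrix, which
is the preceding odd row of `p`. Removing it leaves the reduced matrix shifted by one row, whose
first column has only its top entry. -/
theorem hurwitzMinorInt_succ {p : ℝ[X]} {c : ℝ} {n : ℕ} (hn : p.natDegree = n + 1)
    (hc : c * p.coeff n = p.leadingCoeff) (h1 : 0 < p.coeff n) (j : ℕ) :
    hurwitzMinorInt p (j + 1) = p.coeff n * hurwitzMinorInt (routhStep p c) j := by
  have hd : hurwitzMinorInt p (j + 1) = (Matrix.of fun a b : Fin (j + 1) =>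
      hurwitzInt (routhStep p c) (a + 2) (b + 1)).det := by
    refine Matrix.det_eq_of_forall_row_eq_smul_add_pred
      (fun i : Fin j => if Even (i : ℕ) then c else 0) (fun b => ?_) fun i b => ?_
    · simp only [Matrix.of_apply]
      rw [hurwitzInt_routhStep hn hc h1, if_neg (by simp)]
      simp
    · simp only [Matrix.of_apply]
      rw [hurwitzInt_routhStep hn hc h1, hurwitzInt_routhStep hn hc h1 _ (_ : ℤ)]
      have e1 : Even (((i.succ : ℕ) : ℤ) + 1) ↔ Even (i : ℕ) := by
        rw [Fin.val_succ]; push_cast; rw [add_assoc, Int.even_add]; simp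
      have e2 : Even (((i.castSucc : ℕ) : ℤ) + 1) ↔ ¬ Even (i : ℕ) := by
        rw [Fin.val_castSucc, Int.even_add_one]; simp
      rw [if_congr e1 rfl rfl, if_congr e2 rfl rfl]
      by_cases h : Even (i : ℕ)
      · simp [h, add_assoc]
      · simp only [h, not_false_eq_true, if_true, if_false, zero_mul, add_zero, Fin.val_succ]
        push_cast
        ring_nf
  rw [hd, Matrix.det_succ_column_zero, Fin.sum_univ_succ, Finset.sum_eq_zero]
  · have hl : descCoeffInt (routhStep p c) 0 = p.coeff n := by
      simp [descCoeffInt, descCoeff, natDegree_routhStep hn hc h1, coeff_routhStep_self hn hc]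
    rw [add_zero, hurwitzMinorInt]
    congr 1
    · simp [hurwitzInt, hl]
    · congr 1
      ext a b
      simp only [Matrix.submatrix_apply, Matrix.of_apply, Fin.zero_succAbove, Fin.val_succ,
        hurwitzInt]
      congr 1
      push_cast
      ring
  · intro i _
    have h0 : hurwitzInt (routhStep p c) (((i.succ : Fin (j + 1)) : ℕ) + 2)
        (((0 : Fin (j + 1)) : ℕ) + 1) = 0 := by
      rw [hurwitzInt, descCoeffInt, if_neg]
      simp only [Fin.val_succ, Fin.val_zero]
      omega
    rw [Matrix.of_apply, h0, mul_zero, zero_mul]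

/-! ### Zeros on the imaginary axis -/

/-- All complex zeros of `p` lie in the closed left half-plane. -/
def ZerosInClosedLeftHalfPlane (p : ℝ[X]) : Prop := ∀ z ∈ p.aroots ℂ, z.re ≤ 0

/-- The number of zeros of `p` on the imaginary axis, with multiplicity. -/
noncomputable def imaginaryZeroCount (p : ℝ[X]) : ℕ := (p.aroots ℂ).countP (fun z => z.re = 0)

theorem exists_isQuasiStableWithIndex_iff (p : ℝ[X]) :
    (∃ m : ℕ, p.natDegree - 2 ≤ m ∧ IsQuasiStableWithIndex p m) ↔
      ZerosInClosedLeftHalfPlane p ∧ imaginaryZeroCount p ≤ 2 := by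
  constructor
  · rintro ⟨m, hm, hmn, hz, hcount⟩
    exact ⟨hz, by rw [imaginaryZeroCount, hcount]; omega⟩
  · rintro ⟨hz, hcount⟩
    have hle : imaginaryZeroCount p ≤ p.natDegree := by
      refine (Multiset.countP_le_card _ _).trans ?_
      refine (card_roots' _).trans ?_
      exact natDegree_map_le
    exact ⟨p.natDegree - imaginaryZeroCount p, by omega, by omega, hz,
      by rw [Nat.sub_sub_self hle]; rfl⟩

theorem zerosInClosedLeftHalfPlane_iff {p : ℝ[X]} (hp : p ≠ 0) :
    ZerosInClosedLeftHalfPlane p ↔ ∀ z : ℂ, 0 < z.re → aeval z p ≠ 0 := by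
  simp only [ZerosInClosedLeftHalfPlane, mem_aroots, hp, ne_eq, not_false_eq_true, true_and]
  exact forall_congr' fun z => ⟨fun h h0 hz => (h hz).not_gt h0, fun h hz => not_lt.1 fun h0 => h h0 hz⟩

/-- The reflection z ↦ -conj z fixes the axis pointwise, and conjugation preserves real
coefficients. -/
theorem Polynomial.X_sub_C_pow_dvd_map_comp_neg_X {p : ℝ[X]} {w : ℂ} (hw : w.re = 0) {k : ℕ}
    (h : (X - C w) ^ k ∣ p.map (algebraMap ℝ ℂ)) :
    (X - C w) ^ k ∣ (p.comp (-X)).map (algebraMap ℝ ℂ) := by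
  have h1 := _root_.map_dvd (mapRingHom (starRingEnd ℂ)) h
  have h2 := _root_.map_dvd (compRingHom (-X : ℂ[X])) h1
  have hw' : (starRingEnd ℂ) w = -w := by
    apply Complex.ext <;> simp [hw]
  have e1 : compRingHom (-X : ℂ[X]) (mapRingHom (starRingEnd ℂ) (p.map (algebraMap ℝ ℂ))) =
      (p.comp (-X)).map (algebraMap ℝ ℂ) := by
    have : (starRingEnd ℂ).comp (algebraMap ℝ ℂ) = algebraMap ℝ ℂ := by
      ext x; simp
    simp [Polynomial.map_map, this, Polynomial.map_comp]
  have e2 : compRingHom (-X : ℂ[X]) (mapRingHom (starRingEnd ℂ) ((X - C w) ^ k)) =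
      (-1) ^ k * (X - C w) ^ k := by
    rw [map_pow, map_pow, ← mul_pow]
    congr 1
    simp [hw']
    ring
  rw [e1, e2] at h2
  exact (dvd_mul_left _ _).trans h2

theorem rootMultiplicity_le_of_eq_add_mul_comp_neg_X {p q u v : ℝ[X]} (hp : p ≠ 0)
    (h : p = u * q + v * q.comp (-X)) {w : ℂ} (hw : w.re = 0) :
    (q.map (algebraMap ℝ ℂ)).rootMultiplicity w ≤ (p.map (algebraMap ℝ ℂ)).rootMultiplicity w := by
  rw [le_rootMultiplicity_iff (map_ne_zero hp), h]
  have h1 := pow_rootMultiplicity_dvd (q.map (algebraMap ℝ ℂ)) w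
  have h2 := Polynomial.X_sub_C_pow_dvd_map_comp_neg_X hw h1
  rw [Polynomial.map_add, Polynomial.map_mul, Polynomial.map_mul]
  exact dvd_add (h1.mul_left _) (h2.mul_left _)

section
variable {p : ℝ[X]} {c : ℝ} {n : ℕ} (hn : p.natDegree = n + 1)
  (hc : c * p.coeff n = p.leadingCoeff) (h1 : 0 < p.coeff n)
include hn hc h1

/-- Each of the two polynomials is a combination of the other and its reflection, so multiplicities
on the axis agree. -/
theorem imaginaryZeroCount_routhStep :
    imaginaryZeroCount (routhStep p c) = imaginaryZeroCount p := by
  have hp : p ≠ 0 := by rintro rfl; simp at hn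
  have hq : routhStep p c ≠ 0 := by
    intro h
    have := coeff_routhStep_self hn hc
    rw [h, coeff_zero] at this
    exact h1.ne this
  simp only [imaginaryZeroCount, Multiset.countP_eq_card_filter]
  congr 1
  ext w
  rw [Multiset.count_filter, Multiset.count_filter]
  split_ifs with hw
  · rw [aroots, aroots, count_roots, count_roots]
    refine le_antisymm ?_ ?_
    · refine rootMultiplicity_le_of_eq_add_mul_comp_neg_X hp
        (u := 1 + C (c / 2) * X) (v := C (c / 2) * X * C ((-1) ^ (routhStep p c).natDegree)) ?_ hw
      conv_lhs => rw [eq_routhStep_add hn hc h1]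
      ring
    · refine rootMultiplicity_le_of_eq_add_mul_comp_neg_X hq
        (u := 1 - C (c / 2) * X) (v := C (c / 2) * X * C ((-1) ^ p.natDegree)) ?_ hw
      rw [routhStep]
      ring
  · rfl

end

/-! ### The closed left half-plane under the Routh step -/

/-- Factor by factor: a point of the right half-plane is at least as far from each `w` as its mirror
image is, and strictly farther when `w.re < 0`. -/
theorem norm_prod_reflect_le {z : ℂ} (hz : 0 < z.re) (S : Multiset ℂ) (hS : ∀ w ∈ S, w.re ≤ 0) :
    0 < (S.map fun w => ‖z - w‖).prod ∧
    (S.map fun w => ‖-(starRingEnd ℂ) z - w‖).prod ≤ (S.map fun w => ‖z - w‖).prod ∧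
    ((∃ w ∈ S, w.re < 0) →
      (S.map fun w => ‖-(starRingEnd ℂ) z - w‖).prod < (S.map fun w => ‖z - w‖).prod) := by
  induction S using Multiset.induction with
  | empty => simp
  | cons a S ih =>
    obtain ⟨h1, h2, h3⟩ := ih fun w hw => hS w (Multiset.mem_cons_of_mem hw)
    have ha := hS a (Multiset.mem_cons_self a S)
    have hsq : ‖z - a‖ ^ 2 - ‖-(starRingEnd ℂ) z - a‖ ^ 2 = -4 * z.re * a.re := by
      rw [← Complex.normSq_eq_norm_sq, ← Complex.normSq_eq_norm_sq, Complex.normSq_apply,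
        Complex.normSq_apply]
      simp
      ring
    have h0 : 0 < ‖z - a‖ := by
      rw [norm_pos_iff, sub_ne_zero]
      rintro rfl
      linarith
    have hle : ‖-(starRingEnd ℂ) z - a‖ ≤ ‖z - a‖ := by
      rw [← sq_le_sq₀ (norm_nonneg _) (norm_nonneg _)]
      nlinarith
    simp only [Multiset.map_cons, Multiset.prod_cons, Multiset.mem_cons, exists_eq_or_imp]
    have hnn : 0 ≤ (S.map fun w => ‖-(starRingEnd ℂ) z - w‖).prod :=
      Multiset.prod_nonneg (by simp)
    refine ⟨mul_pos h0 h1, mul_le_mul hle h2 hnn h0.le, ?_⟩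
    rintro (h | h)
    · have hlt : ‖-(starRingEnd ℂ) z - a‖ < ‖z - a‖ := by
        rw [← sq_lt_sq₀ (norm_nonneg _) (norm_nonneg _)]
        nlinarith
      exact (mul_le_mul_of_nonneg_left h2 (norm_nonneg _)).trans_lt (mul_lt_mul_of_pos_right hlt h1)
    · exact (mul_le_mul_of_nonneg_right hle hnn).trans_lt (mul_lt_mul_of_pos_left (h3 h) h0)

theorem norm_aeval_eq_prod (p : ℝ[X]) (z : ℂ) :
    ‖aeval z p‖ = |p.leadingCoeff| * ((p.aroots ℂ).map fun w => ‖z - w‖).prod := by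
  have h := (IsAlgClosed.splits (p.map (algebraMap ℝ ℂ))).eval_eq_prod_roots z
  rw [eval_map_algebraMap, leadingCoeff_map] at h
  have h2 (S : Multiset ℂ) : ‖S.prod‖ = (S.map norm).prod :=
    (Multiset.prod_hom S (normHom : ℂ →*₀ ℝ)).symm
  rw [h, norm_mul, h2, Multiset.map_map]
  simp [aroots]

theorem norm_aeval_neg (p : ℝ[X]) (z : ℂ) :
    ‖aeval (-z) p‖ = ‖aeval (-(starRingEnd ℂ) z) p‖ := by
  have : aeval (-(starRingEnd ℂ) z) p = (starRingEnd ℂ) (aeval (-z) p) := by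
    rw [← map_neg, Polynomial.aeval_conj]
  rw [this, Complex.norm_conj]

theorem ZerosInClosedLeftHalfPlane.norm_aeval_neg_le {p : ℝ[X]}
    (hp : ZerosInClosedLeftHalfPlane p) {z : ℂ} (hz : 0 < z.re) :
    ‖aeval (-z) p‖ ≤ ‖aeval z p‖ := by
  rw [norm_aeval_neg, norm_aeval_eq_prod, norm_aeval_eq_prod]
  exact mul_le_mul_of_nonneg_left (norm_prod_reflect_le hz _ hp).2.1 (abs_nonneg _)

theorem ZerosInClosedLeftHalfPlane.norm_aeval_neg_lt {p : ℝ[X]} (h0 : p ≠ 0)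
    (hp : ZerosInClosedLeftHalfPlane p) (h : ∃ w ∈ p.aroots ℂ, w.re < 0) {z : ℂ} (hz : 0 < z.re) :
    ‖aeval (-z) p‖ < ‖aeval z p‖ := by
  rw [norm_aeval_neg, norm_aeval_eq_prod, norm_aeval_eq_prod]
  exact mul_lt_mul_of_pos_left ((norm_prod_reflect_le hz _ hp).2.2 h)
    (abs_pos.2 (leadingCoeff_ne_zero.2 h0))

theorem coeff_pred_natDegree_eq {p : ℝ[X]} {n : ℕ} (hn : p.natDegree = n + 1) :
    p.coeff n = p.leadingCoeff * ((p.aroots ℂ).map fun w => -w.re).sum := by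
  have h := (IsAlgClosed.splits (p.map (algebraMap ℝ ℂ))).nextCoeff_eq_neg_sum_roots_mul_leadingCoeff
  rw [nextCoeff_of_natDegree_pos (by rw [natDegree_map]; omega), natDegree_map, hn,
    leadingCoeff_map, coeff_map] at h
  have h2 := congrArg Complex.re h
  simp only [Nat.add_sub_cancel] at h2
  have h3 : ((p.aroots ℂ).map fun w => -w.re).sum = -(p.aroots ℂ).sum.re := by
    induction p.aroots ℂ using Multiset.induction with
    | empty => simp
    | cons a S ih => simp [ih]; ring
  rw [h3]
  simpa [aroots] using h2

theorem ZerosInClosedLeftHalfPlane.coeff_pred_nonneg {p : ℝ[X]} {n : ℕ}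
    (hp : ZerosInClosedLeftHalfPlane p) (hl : 0 < p.leadingCoeff) (hn : p.natDegree = n + 1) :
    0 ≤ p.coeff n := by
  rw [coeff_pred_natDegree_eq hn]
  refine mul_nonneg hl.le (Multiset.sum_nonneg ?_)
  simp only [Multiset.mem_map]
  rintro _ ⟨w, hw, rfl⟩
  exact neg_nonneg.2 (hp w hw)

theorem ZerosInClosedLeftHalfPlane.coeff_pred_pos_iff {p : ℝ[X]} {n : ℕ}
    (hp : ZerosInClosedLeftHalfPlane p) (hl : 0 < p.leadingCoeff) (hn : p.natDegree = n + 1) :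
    0 < p.coeff n ↔ ∃ w ∈ p.aroots ℂ, w.re < 0 := by
  constructor
  · intro h
    by_contra! hall
    rw [coeff_pred_natDegree_eq hn, Multiset.sum_eq_zero, mul_zero] at h
    · exact lt_irrefl _ h
    · simp only [Multiset.mem_map]
      rintro _ ⟨w, hw, rfl⟩
      exact neg_eq_zero.2 (le_antisymm (hp w hw) (hall w hw))
  · rintro ⟨w, hw, hw0⟩
    rw [coeff_pred_natDegree_eq hn]
    refine mul_pos hl ((neg_pos.2 hw0).trans_le ?_)
    refine Multiset.single_le_sum ?_ _ (Multiset.mem_map_of_mem _ hw)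
    simp only [Multiset.mem_map]
    rintro _ ⟨w, hw, rfl⟩
    exact neg_nonneg.2 (hp w hw)

theorem aeval_reflect (p : ℝ[X]) (k : ℕ) (z : ℂ) :
    aeval z (C ((-1) ^ k) * p.comp (-X)) = (-1) ^ k * aeval (-z) p := by
  simp [aeval_comp]

theorem norm_aeval_reflect (p : ℝ[X]) (k : ℕ) (z : ℂ) :
    ‖aeval z (C ((-1) ^ k) * p.comp (-X))‖ = ‖aeval (-z) p‖ := by
  rw [aeval_reflect]
  simp

theorem Complex.re_one_add_nonneg_of_norm_le {a b : ℂ} (hab : ‖b‖ ≤ ‖a‖) :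
    0 ≤ (1 + b / a).re := by
  have h : ‖b / a‖ ≤ 1 := by
    rw [norm_div]
    exact div_le_one_of_le₀ hab (norm_nonneg _)
  have := (abs_le.1 ((Complex.abs_re_le_norm (b / a)).trans h)).1
  simp only [Complex.add_re, Complex.one_re]
  linarith

theorem Complex.re_add_div_sub_nonneg_of_norm_le {a b : ℂ} (hab : ‖b‖ ≤ ‖a‖) :
    0 ≤ ((a + b) / (a - b)).re := by
  have h : ((a + b) / (a - b)).re = (‖a‖ ^ 2 - ‖b‖ ^ 2) / Complex.normSq (a - b) := by
    rw [Complex.div_re, ← Complex.normSq_eq_norm_sq, ← Complex.normSq_eq_norm_sq, ← add_div]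
    congr 1
    simp only [Complex.normSq_apply, Complex.add_re, Complex.sub_re, Complex.add_im,
      Complex.sub_im]
    ring
  rw [h]
  refine div_nonneg (sub_nonneg.2 ?_) (Complex.normSq_nonneg _)
  exact pow_le_pow_left₀ (norm_nonneg _) hab 2

/-- If `F` is holomorphic with nonnegative real part on the right half-plane and `F x - c x` is
bounded below for large positive `x`, then `F z - c z` has nonnegative real part. -/
theorem Complex.re_sub_mul_nonneg_of_re_nonneg {F : ℂ → ℂ} {c : ℝ} (hc : 0 ≤ c)
    (hd : DifferentiableOn ℂ F {z | 0 < z.re}) (hF : ∀ z, 0 < z.re → 0 ≤ (F z).re)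
    {b : ℝ} (hb : ∀ᶠ x : ℝ in Filter.atTop, b ≤ (F x - c * x).re) {z : ℂ} (hz : 0 < z.re) :
    0 ≤ (F z - c * z).re := by
  have key : ∀ ε : ℝ, 0 < ε → ∀ w : ℂ, 0 ≤ w.re →
      -(c * ε) ≤ (F (w + ε) - c * (w + ε)).re := by
    intro ε hε w hw
    -- The shift by ε avoids boundary values of `F`. Then `g` has exponential type, is bounded by
    -- e^{cε} on the axis and is bounded on the positive reals, so Phragmén–Lindelöf applies.
    set g : ℂ → ℂ := fun w => Complex.exp (-(F (w + ε) - c * (w + ε))) with hg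
    have hnorm (w : ℂ) : ‖g w‖ = Real.exp (-(F (w + ε) - c * (w + ε)).re) := by
      simp only [hg, Complex.norm_exp, Complex.neg_re]
    have hre (w : ℂ) (hw : 0 ≤ w.re) : ‖g w‖ ≤ Real.exp (c * (w.re + ε)) := by
      rw [hnorm, Real.exp_le_exp]
      have := hF (w + ε) (by simp; linarith)
      simp
      linarith
    have hle : ‖g w‖ ≤ Real.exp (c * ε) := by
      refine PhragmenLindelof.right_half_plane_of_bounded_on_real ?_ ⟨1, by norm_num, c, ?_⟩ ?_ ?_ hw
      · refine DifferentiableOn.diffContOnCl ?_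
        have hcl : closure {z : ℂ | 0 < z.re} ⊆ {z | 0 ≤ z.re} :=
          closure_minimal (fun z (hz : 0 < z.re) => hz.le) (isClosed_le continuous_const Complex.continuous_re)
        refine DifferentiableOn.mono ?_ hcl
        have h1 : DifferentiableOn ℂ (fun w : ℂ => F (w + ε)) {z | 0 ≤ z.re} := by
          refine hd.comp (by fun_prop) fun z hz => ?_
          have hz : 0 ≤ z.re := hz
          simp
          linarith
        refine DifferentiableOn.cexp (DifferentiableOn.neg (h1.sub ?_))
        fun_prop
      · refine Asymptotics.IsBigO.of_bound (Real.exp (c * ε)) ?_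
        filter_upwards [Filter.mem_inf_of_right (Filter.mem_principal_self _)] with z hz
        have hz : 0 < z.re := hz
        refine (hre z hz.le).trans ?_
        rw [Real.norm_eq_abs, Real.abs_exp, ← Real.exp_add, Real.exp_le_exp, Real.rpow_one]
        have := mul_le_mul_of_nonneg_left (Complex.re_le_norm z) hc
        linarith
      · refine Filter.isBoundedUnder_of_eventually_le (a := Real.exp (-b)) ?_
        have ht : Filter.Tendsto (fun x : ℝ => x + ε) Filter.atTop Filter.atTop :=
          Filter.tendsto_atTop_add_const_right _ _ Filter.tendsto_id
        filter_upwards [ht.eventually hb] with x hx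
        rw [hnorm, Real.exp_le_exp]
        push_cast at hx
        linarith
      · intro x
        refine (hre _ (by simp)).trans ?_
        simp
    rw [hnorm, Real.exp_le_exp] at hle
    linarith
  have hlim : Filter.Tendsto (fun ε : ℝ => -(c * ε)) (nhdsWithin 0 (Set.Ioi 0)) (nhds 0) := by
    refine tendsto_nhdsWithin_of_tendsto_nhds (Continuous.tendsto' (by fun_prop) _ _ (by simp))
  refine le_of_tendsto hlim ?_
  filter_upwards [Ioo_mem_nhdsGT hz] with ε hε
  have := key ε hε.1 (z - ε) (by simp; exact hε.2.le)
  simpa using this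

theorem Polynomial.eventually_eval_pos {p : ℝ[X]} (h : 0 < p.leadingCoeff) :
    ∀ᶠ x in Filter.atTop, 0 < p.eval x := by
  rcases lt_or_ge 0 p.degree with hd | hd
  · exact (p.tendsto_atTop_of_leadingCoeff_nonneg hd h.le).eventually_gt_atTop 0
  · rw [eq_C_of_degree_le_zero hd] at h ⊢
    exact .of_forall fun x => by simpa using h

section
variable {p : ℝ[X]} {c : ℝ} {n : ℕ} (hn : p.natDegree = n + 1)
  (hc : c * p.coeff n = p.leadingCoeff) (h1 : 0 < p.coeff n) (hc0 : 0 < c)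
include hn hc h1 hc0

/-- A zero z of `p` with Re z > 0 would satisfy 1/z = -(c/2)(1 + b/a) with |b| ≤ |a|, but the right
side has real part at most 0. -/
theorem ZerosInClosedLeftHalfPlane.of_routhStep
    (hq : ZerosInClosedLeftHalfPlane (routhStep p c)) : ZerosInClosedLeftHalfPlane p := by
  have hp0 : p ≠ 0 := by rintro rfl; simp at hn
  have hq0 : routhStep p c ≠ 0 := by
    intro h
    have := coeff_routhStep_self hn hc
    rw [h, coeff_zero] at this
    exact h1.ne this
  rw [zerosInClosedLeftHalfPlane_iff hp0]
  intro z hz h0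
  set a := aeval z (routhStep p c) with ha
  set b := aeval z (C ((-1) ^ (routhStep p c).natDegree) * (routhStep p c).comp (-X)) with hb
  have ha0 : a ≠ 0 := (zerosInClosedLeftHalfPlane_iff hq0).1 hq z hz
  have hab : ‖b‖ ≤ ‖a‖ := by
    rw [hb, norm_aeval_reflect]
    exact hq.norm_aeval_neg_le hz
  have heq : a + (c / 2 * z) * (a + b) = 0 := by
    have h := congrArg (aeval z) (eq_routhStep_add hn hc h1)
    rw [h0, map_add, map_mul, map_mul, map_add, ← ha, ← hb, aeval_C, aeval_X] at h
    simpa using h.symm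
  have hz0 : z ≠ 0 := by rintro rfl; simp at hz
  have hcc : (c : ℂ) ≠ 0 := by exact_mod_cast hc0.ne'
  have h2 : z⁻¹ = -((c / 2 : ℝ) * (1 + b / a)) := by
    push_cast
    field_simp
    linear_combination 2 * heq
  have h3 : 0 < (z⁻¹).re := by
    rw [Complex.inv_re]
    exact div_pos hz (Complex.normSq_pos.2 hz0)
  have h4 := Complex.re_one_add_nonneg_of_norm_le hab
  rw [h2, Complex.neg_re, Complex.re_ofReal_mul] at h3
  have := mul_nonneg (half_pos hc0).le h4
  linarith

/-- With r the signed reflection of p and F = (p + r)/(p - r), the reduced polynomial is (p - r)/2 ·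
(1 + F - cz). Here Re F ≥ 0 as |r| < |p|, and subtracting cz keeps the real part nonnegative. -/
theorem ZerosInClosedLeftHalfPlane.routhStep
    (hp : ZerosInClosedLeftHalfPlane p) : ZerosInClosedLeftHalfPlane (routhStep p c) := by
  have hp0 : p ≠ 0 := by rintro rfl; simp at hn
  have hl : 0 < p.leadingCoeff := hc ▸ mul_pos hc0 h1
  have hq0 : _root_.routhStep p c ≠ 0 := by
    intro h
    have := coeff_routhStep_self hn hc
    rw [h, coeff_zero] at this
    exact h1.ne this
  have hex := (hp.coeff_pred_pos_iff hl hn).1 h1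
  rw [zerosInClosedLeftHalfPlane_iff hq0]
  set r : ℝ[X] := C ((-1) ^ p.natDegree) * p.comp (-X) with hr
  have hlt (z : ℂ) (hz : 0 < z.re) : ‖aeval z r‖ < ‖aeval z p‖ := by
    rw [hr, norm_aeval_reflect]
    exact hp.norm_aeval_neg_lt hp0 hex hz
  have hne (z : ℂ) (hz : 0 < z.re) : aeval z p - aeval z r ≠ 0 := by
    intro h
    have := hlt z hz
    rw [sub_eq_zero.1 h] at this
    exact lt_irrefl _ this
  have hq (z : ℂ) : aeval z (_root_.routhStep p c) =
      aeval z p - c / 2 * z * (aeval z p - aeval z r) := by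
    simp [_root_.routhStep, hr]
  set F : ℂ → ℂ := fun z => (aeval z p + aeval z r) / (aeval z p - aeval z r) with hF
  have hqF (z : ℂ) (hz : 0 < z.re) : aeval z (_root_.routhStep p c) =
      (aeval z p - aeval z r) / 2 * (1 + (F z - c * z)) := by
    have := hne z hz
    rw [hq, hF]
    field_simp
    ring
  -- For large real x both the reduced polynomial and p - r are positive, hence so is 1 + F - cx.
  have hb : ∀ᶠ x : ℝ in Filter.atTop, (-1 : ℝ) ≤ (F x - c * x).re := by
    have hcast (f : ℝ[X]) (x : ℝ) : aeval (x : ℂ) f = ((f.eval x : ℝ) : ℂ) :=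
      aeval_algebraMap_apply_eq_algebraMap_eval x f
    have hlq : 0 < (_root_.routhStep p c).leadingCoeff := by
      rwa [leadingCoeff_routhStep hn hc h1]
    filter_upwards [Polynomial.eventually_eval_pos hl, Polynomial.eventually_eval_pos hlq,
      Filter.eventually_gt_atTop 0] with x hpx hqx hx
    have e1 := hlt x (by simpa using hx)
    have e2 := hqF x (by simpa using hx)
    rw [hcast, hcast, Complex.norm_real, Complex.norm_real, Real.norm_eq_abs, Real.norm_eq_abs,
      abs_of_pos hpx] at e1
    have e3 : 0 < (p.eval x - r.eval x) / 2 := by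
      have := (abs_lt.1 e1).2
      linarith
    have e4 : (1 + (F x - c * x)).re = (_root_.routhStep p c).eval x / ((p.eval x - r.eval x) / 2) := by
      rw [hcast, hcast, hcast, show ((p.eval x : ℝ) - (r.eval x : ℝ) : ℂ) / 2 =
        (((p.eval x - r.eval x) / 2 : ℝ) : ℂ) by push_cast; ring] at e2
      rw [eq_div_iff e3.ne', mul_comm, ← Complex.re_ofReal_mul, ← e2, Complex.ofReal_re]
    have e5 := div_pos hqx e3
    rw [← e4, Complex.add_re, Complex.one_re] at e5
    linarith
  intro z hz h0
  have hnn := Complex.re_sub_mul_nonneg_of_re_nonneg (F := F) hc0.le ?_ ?_ hb hz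
  · rw [hqF z hz, mul_eq_zero] at h0
    rcases h0 with h0 | h0
    · exact hne z hz (by simpa using h0)
    · have := congrArg Complex.re h0
      rw [Complex.add_re, Complex.one_re, Complex.zero_re] at this
      linarith
  · refine DifferentiableOn.div ?_ ?_ hne
    · exact ((Polynomial.differentiable_aeval p).add (Polynomial.differentiable_aeval r)).differentiableOn
    · exact ((Polynomial.differentiable_aeval p).sub (Polynomial.differentiable_aeval r)).differentiableOn
  · intro z hz
    exact Complex.re_add_div_sub_nonneg_of_norm_le (hlt z hz).le
end

/-! ### Low degrees and the two inductions -/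

theorem hurwitzMinorInt_nonneg {p : ℝ[X]} (h : IsTotallyNonnegative (hurwitzMatrix p)) {j : ℕ}
    (hj : j ≤ p.natDegree) : 0 ≤ hurwitzMinorInt p j := by
  rw [← hurwitzMinor_eq p j hj]
  exact h j (Fin.castLEOrderEmb hj) (Fin.castLEOrderEmb hj)

theorem hurwitzMinorInt_pos {p : ℝ[X]} (h : IsTotallyNonnegative (hurwitzMatrix p)) {m : ℕ}
    (hm : m ≤ p.natDegree) (h0 : hurwitzMinor p m hm ≠ 0) {j : ℕ} (hj : j ≤ m) :
    0 < hurwitzMinorInt p j := by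
  have := (h.submatrix (Fin.castLEOrderEmb hm) (Fin.castLEOrderEmb hm)).leading_minor_pos h0 j hj
  rw [← hurwitzMinor_eq p j (hj.trans hm)]
  exact this

theorem coeff_zero_nonneg_of_isTotallyNonnegative {p : ℝ[X]} (hl : 0 < p.leadingCoeff)
    (h : IsTotallyNonnegative (hurwitzMatrix p)) : 0 ≤ p.coeff 0 := by
  rcases Nat.eq_zero_or_pos p.natDegree with h0 | h0
  · rw [leadingCoeff, h0] at hl
    exact hl.le
  -- The last diagonal entry is a_n.
  · have := h.entry_nonneg ⟨p.natDegree - 1, by omega⟩ ⟨p.natDegree - 1, by omega⟩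
    rw [hurwitzMatrix, Matrix.of_apply, if_pos (by simp; omega), descCoeff,
      if_pos (by simp; omega)] at this
    convert this using 2
    simp only
    omega

theorem zerosInClosedLeftHalfPlane_of_natDegree_le_two {p : ℝ[X]} (hn : p.natDegree ≤ 2)
    (h0 : 0 < p.coeff 0) (h1 : 0 ≤ p.coeff 1) (h2 : 0 ≤ p.coeff 2) :
    ZerosInClosedLeftHalfPlane p := by
  rw [zerosInClosedLeftHalfPlane_iff (by rintro rfl; simp at h0)]
  intro z hz h
  rw [aeval_eq_sum_range' (Nat.lt_succ_of_le hn)] at h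
  simp only [Finset.sum_range_succ, Finset.sum_range_zero] at h
  have hre := congrArg Complex.re h
  have him := congrArg Complex.im h
  simp [pow_two] at hre him
  have hy : z.im * (2 * p.coeff 2 * z.re + p.coeff 1) = 0 := by linear_combination him
  rcases mul_eq_zero.1 hy with hy | hy
  · rw [hy] at hre
    have := mul_nonneg h1 hz.le
    have := mul_nonneg h2 (mul_self_nonneg z.re)
    linarith
  · have e1 := mul_nonneg h2 hz.le
    have e2 : p.coeff 2 * z.re = 0 := by linarith
    have e3 : p.coeff 2 = 0 := (mul_eq_zero.1 e2).resolve_right hz.ne'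
    have e4 : p.coeff 1 = 0 := by linarith
    rw [e3, e4] at hre
    linarith

theorem imaginaryZeroCount_le_natDegree (p : ℝ[X]) : imaginaryZeroCount p ≤ p.natDegree :=
  ((Multiset.countP_le_card _ _).trans (card_roots' _)).trans natDegree_map_le

/-- The sufficiency part of the Routh-Hurwitz criterion with at most two zeros on the axis. -/
theorem zerosInClosedLeftHalfPlane_of_hurwitzMinorInt {n : ℕ} : ∀ {p : ℝ[X]}, p.natDegree = n →
    0 < p.leadingCoeff → 0 < p.coeff 0 → (∀ j, j ≤ n - 2 → 0 < hurwitzMinorInt p j) →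
    0 ≤ hurwitzMinorInt p (n - 1) →
    ZerosInClosedLeftHalfPlane p ∧ imaginaryZeroCount p ≤ 2 := by
  induction n with
  | zero =>
    intro p hn hl h0 _ _
    refine ⟨zerosInClosedLeftHalfPlane_of_natDegree_le_two (by omega) h0 ?_ ?_,
      (imaginaryZeroCount_le_natDegree p).trans (by omega)⟩ <;>
    rw [coeff_eq_zero_of_natDegree_lt (by omega)]
  | succ n ih =>
    intro p hn hl h0 hpos hnn
    rcases lt_or_ge n 2 with h2 | h2
    · refine ⟨zerosInClosedLeftHalfPlane_of_natDegree_le_two (by omega) h0 ?_ ?_,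
        (imaginaryZeroCount_le_natDegree p).trans (by omega)⟩
      · interval_cases n
        · rw [leadingCoeff, hn] at hl
          exact hl.le
        -- In degree 2 the middle coefficient is Δ_1 = Δ_{n-1}, which may vanish.
        · simpa [hurwitzMinorInt_one hn] using hnn
      · interval_cases n
        · rw [coeff_eq_zero_of_natDegree_lt (by omega)]
        · rw [leadingCoeff, hn] at hl
          exact hl.le
    · have h1 : 0 < p.coeff n := by
        rw [← hurwitzMinorInt_one hn]
        exact hpos 1 (by omega)
      obtain ⟨c, hc⟩ : ∃ c, c * p.coeff n = p.leadingCoeff :=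
        ⟨p.leadingCoeff / p.coeff n, div_mul_cancel₀ _ h1.ne'⟩
      have hc0 : 0 < c := pos_of_mul_pos_left (hc ▸ hl) h1.le
      have hmin (j : ℕ) := hurwitzMinorInt_succ hn hc h1 j
      obtain ⟨hq, hcount⟩ := ih (natDegree_routhStep hn hc h1)
        (by rwa [leadingCoeff_routhStep hn hc h1]) (by rwa [coeff_zero_routhStep])
        (fun j hj => (mul_pos_iff_of_pos_left h1).1 (hmin j ▸ hpos (j + 1) (by omega)))
        (by
          rw [show n + 1 - 1 = (n - 1) + 1 by omega, hmin] at hnn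
          exact (mul_nonneg_iff_of_pos_left h1).1 hnn)
      exact ⟨hq.of_routhStep hn hc h1 hc0, (imaginaryZeroCount_routhStep hn hc h1) ▸ hcount⟩

theorem isTotallyNonnegativeInt_hurwitzInt_of_natDegree_eq_zero {p : ℝ[X]}
    (hn : p.natDegree = 0) (hl : 0 < p.leadingCoeff) :
    IsTotallyNonnegativeInt (hurwitzInt p) := by
  convert IsTotallyNonnegativeInt.of_double hl.le using 3 with i j
  rw [hurwitzInt, descCoeffInt, descCoeff, leadingCoeff, hn]
  by_cases e0 : i = 2 * j
  · simp [e0]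
  · rw [if_neg e0]
    split_ifs <;> first | rfl | omega

/-- Without the middle term, each column is a nonnegative combination of two adjacent columns of the
pattern i = 2j. -/
theorem isTotallyNonnegativeInt_hurwitzInt_of_natDegree_eq_two {p : ℝ[X]}
    (hn : p.natDegree = 2) (hl : 0 < p.leadingCoeff) (h1 : p.coeff 1 = 0) (h0 : 0 ≤ p.coeff 0) :
    IsTotallyNonnegativeInt (hurwitzInt p) := by
  have h := (((IsTotallyNonnegativeInt.of_double zero_le_one).shift 0 (-1)).transpose
    |>.smul_add_smul_succ_row (fun _ => p.coeff 0) (fun _ => p.leadingCoeff) (fun _ => h0)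
      (fun _ => hl.le) (fun _ _ => rfl)).transpose
  convert h using 3 with i j
  rw [hurwitzInt, descCoeffInt, descCoeff, leadingCoeff, hn]
  by_cases e0 : i = 2 * j
  · subst e0; simp
  by_cases e2 : i = 2 * j - 2
  · subst e2; simp; omega
  by_cases e1 : i = 2 * j - 1
  · subst e1; simp [h1]; omega
  · rw [if_neg (show ¬ i + 0 = 2 * (j + -1) by omega),
      if_neg (show ¬ i + 0 = 2 * (j + 1 + -1) by omega)]
    split_ifs <;> first | omega | simp

theorem imaginaryZeroCount_eq_natDegree {p : ℝ[X]} (h : ∀ w ∈ p.aroots ℂ, w.re = 0) :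
    imaginaryZeroCount p = p.natDegree := by
  rw [imaginaryZeroCount, Multiset.countP_eq_card.2 h, aroots,
    ← (IsAlgClosed.splits (p.map (algebraMap ℝ ℂ))).natDegree_eq_card_roots, natDegree_map]

theorem ZerosInClosedLeftHalfPlane.coeff_zero_nonneg_of_coeff_one_eq_zero {p : ℝ[X]}
    (hp : ZerosInClosedLeftHalfPlane p) (hn : p.natDegree = 2) (hl : 0 < p.leadingCoeff)
    (h1 : p.coeff 1 = 0) : 0 ≤ p.coeff 0 := by
  by_contra! h
  have hp0 : p ≠ 0 := by rintro rfl; simp at hn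
  have ha : 0 < p.coeff 2 := by rwa [leadingCoeff, hn] at hl
  have hs : 0 < -p.coeff 0 / p.coeff 2 := div_pos (neg_pos.2 h) ha
  refine (zerosInClosedLeftHalfPlane_iff hp0).1 hp (Real.sqrt (-p.coeff 0 / p.coeff 2) : ℝ)
    (by simpa using hs) ?_
  rw [aeval_eq_sum_range, hn]
  simp only [Finset.sum_range_succ, Finset.sum_range_zero, ← Complex.ofReal_pow,
    Real.sq_sqrt hs.le, h1]
  simp only [Complex.real_smul, ← Complex.ofReal_mul, mul_div_cancel₀ _ ha.ne']
  simp

/-- The necessity part: total nonnegativity, and nonvanishing of the minor of order `n - 2`. -/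
theorem isTotallyNonnegativeInt_of_zerosInClosedLeftHalfPlane {n : ℕ} : ∀ {p : ℝ[X]},
    p.natDegree = n → 0 < p.leadingCoeff → p.coeff 0 ≠ 0 → ZerosInClosedLeftHalfPlane p →
    imaginaryZeroCount p ≤ 2 →
    IsTotallyNonnegativeInt (hurwitzInt p) ∧ hurwitzMinorInt p (n - 2) ≠ 0 := by
  induction n with
  | zero =>
    intro p hn hl _ _ _
    exact ⟨isTotallyNonnegativeInt_hurwitzInt_of_natDegree_eq_zero hn hl,
      by simp [hurwitzMinorInt_zero]⟩
  | succ n ih =>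
    intro p hn hl h0 hp hcount
    rcases (hp.coeff_pred_nonneg hl hn).eq_or_lt with h1 | h1
    -- The real parts are nonpositive with sum zero, so all vanish. Degree 1 is then excluded by the
    -- nonzero constant term.
    · have himag : ∀ w ∈ p.aroots ℂ, w.re = 0 := by
        intro w hw
        by_contra hne
        exact ((hp.coeff_pred_pos_iff hl hn).2 ⟨w, hw, (hp w hw).lt_of_ne hne⟩).ne h1
      rw [imaginaryZeroCount_eq_natDegree himag, hn] at hcount
      have : n < 2 := by omega
      interval_cases n
      · exact absurd h1.symm h0
      · exact ⟨isTotallyNonnegativeInt_hurwitzInt_of_natDegree_eq_two hn hl h1.symm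
          (hp.coeff_zero_nonneg_of_coeff_one_eq_zero hn hl h1.symm),
          by simp [hurwitzMinorInt_zero]⟩
    · obtain ⟨c, hc⟩ : ∃ c, c * p.coeff n = p.leadingCoeff :=
        ⟨p.leadingCoeff / p.coeff n, div_mul_cancel₀ _ h1.ne'⟩
      have hc0 : 0 < c := pos_of_mul_pos_left (hc ▸ hl) h1.le
      obtain ⟨hT, hM⟩ := ih (natDegree_routhStep hn hc h1)
        (by rwa [leadingCoeff_routhStep hn hc h1]) (by rwa [coeff_zero_routhStep])
        (hp.routhStep hn hc h1 hc0) ((imaginaryZeroCount_routhStep hn hc h1).trans_le hcount)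
      refine ⟨isTotallyNonnegativeInt_hurwitzInt_of_routhStep hn hc h1 hc0.le hT, ?_⟩
      rcases lt_or_ge n 2 with h2 | h2
      · rw [show n + 1 - 2 = 0 by omega, hurwitzMinorInt_zero]
        exact one_ne_zero
      · rw [show n + 1 - 2 = (n - 2) + 1 by omega, hurwitzMinorInt_succ hn hc h1]
        exact mul_ne_zero h1.ne' hM

theorem theorem4p11 (p : ℝ[X]) (hlead : 0 < p.leadingCoeff) (hconst : p.coeff 0 ≠ 0) :
    (∃ m : ℕ, p.natDegree - 2 ≤ m ∧ IsQuasiStableWithIndex p m) ↔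
      (IsTotallyNonnegative (hurwitzMatrix p) ∧
        hurwitzMinor p (p.natDegree - 2) (Nat.sub_le p.natDegree 2) ≠ 0) := by
  rw [exists_isQuasiStableWithIndex_iff]
  constructor
  · rintro ⟨hp, hcount⟩
    obtain ⟨hT, hM⟩ := isTotallyNonnegativeInt_of_zerosInClosedLeftHalfPlane rfl hlead hconst hp hcount
    exact ⟨isTotallyNonnegative_hurwitzMatrix hT, by rwa [hurwitzMinor_eq]⟩
  · rintro ⟨hT, hM⟩
    exact zerosInClosedLeftHalfPlane_of_hurwitzMinorInt rfl hlead
      ((coeff_zero_nonneg_of_isTotallyNonnegative hlead hT).lt_of_ne' hconst)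
      (fun j hj => hurwitzMinorInt_pos hT _ hM hj) (hurwitzMinorInt_nonneg hT (Nat.sub_le _ _))
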